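/- For real $t$ and integers $m\ge 1$, $a$, let $\pi(t;m,a)$ denote the number of primes $p\le t$ with $p\equiv a \pmod m$, and let $\varphi$ be Euler's totient function. There exist absolute constants $C>0$, $\epsilon_0>0$ and $x_0$ such that for every $\epsilon$ with $0<\epsilon<\epsilon_0$ and every real $x\ge x_0$, $$\sum_{1\le m\le x^{1-\epsilon}}\varphi(m)\left(\int_{2}^{m^{1+\epsilon}}\frac{\pi(t;m,1)}{(t-1)^2}\,dt\right)^2\le C\left(\epsilon\log x+\log\log x\right),$$ where $m$ runs over positive integers (for $m=1$ the integral, whose upper limit is then $1$, equals $0$, since $\pi(t;1,1)=0$ for $t<2$). -/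

import Mathlib

/-- `π(t; m, a)`: the number of primes `p ≤ t` with `p ≡ a (mod m)`. -/
noncomputable def primesInAP (t : ℝ) (m a : ℕ) : ℕ :=
  ((Finset.Iic ⌊t⌋₊).filter (fun p => p.Prime ∧ p ≡ a [MOD m])).card

/-!
If the terms `k m + 1` indexed by `k ∈ S ⊆ [1, K]` have no prime factor up to `z`, then Ramanujan's
sums satisfy `c_q(k m + 1) = μ(q)` there for every `q ≤ z`. Near-orthogonality of the functions
`k ↦ c_q(k m + 1)` for `q` coprime to `m` therefore bounds `#S`, and `z ≈ K ^ (1 / 4)` gives a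
Brun–Titchmarsh inequality: at most `18 (σ(m) / m) K / log (K + 1)` of the `k ≤ K` make `k m + 1`
prime.

Let `A k` be the number of primes among the first `k` terms `j m + 1`. Cutting the integral at the
points `k m + 1` bounds it by `m⁻¹ ∑ k ≤ N, A k / k ^ 2` with `N ≈ m ^ ε`. The square of this sum is
at most twice the part where the second index `l` is the smaller one. There, the Brun–Titchmarsh
bound is used for `A k` only, and its factor `σ(m) / m` is cancelled by `φ(m) σ(m) ≤ m ^ 2`. The
factor `A l` is averaged over `m` in a dyadic block `[M, 2 M)`: since `l m + 1` is symmetric in `l`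
and `m`, Brun–Titchmarsh now applies with the roles of `l` and `m` exchanged, at the much larger
length `2 M`, and saves a full `log M`. The block contributes
`≪ (1 / log M) ∑ k ≤ N, 1 / k ≪ 1 / log M + ε`, and summing over `M = 2 ^ i ≤ x` gives
`log log x + ε log x`.
-/

open Finset
open scoped ArithmeticFunction.Moebius ArithmeticFunction.sigma

/-! ### Ramanujan sums along an arithmetic progression -/

/-- Ramanujan's sum `c_q(n)`, the sum of the `n`-th powers of the primitive `q`-th roots of unity,
defined by its divisor-sum formula so that it is visibly an integer. -/
def ramanujanSum (q n : ℕ) : ℤ :=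
  ∑ d ∈ q.divisors with d ∣ n, μ (q / d) * d

theorem ramanujanSum_of_coprime {q n : ℕ} (h : q.Coprime n) : ramanujanSum q n = μ q := by
  rcases eq_or_ne q 0 with rfl | hq
  · simp [ramanujanSum]
  have hone : {d ∈ q.divisors | d ∣ n} = {1} := by
    ext d
    simp only [mem_filter, Nat.mem_divisors, mem_singleton]
    exact ⟨fun hd => Nat.eq_one_of_dvd_coprimes h hd.1.1 hd.2, by rintro rfl; simp [hq]⟩
  simp [ramanujanSum, hone]

theorem sum_divisors_moebius (n : ℕ) : ∑ d ∈ n.divisors, μ d = if n = 1 then 1 else 0 := by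
  rw [← ArithmeticFunction.coe_zeta_mul_apply, ArithmeticFunction.coe_zeta_mul_moebius,
    ArithmeticFunction.one_apply]

theorem sum_moebius_div_of_dvd {q : ℕ} (hq : q ≠ 0) (c : ℕ) :
    ∑ d ∈ q.divisors with c ∣ d, μ (q / d) = if c = q then 1 else 0 := by
  by_cases hc : c ∣ q
  · obtain ⟨e, rfl⟩ := hc
    have hc₀ : 0 < c := Nat.pos_of_ne_zero (left_ne_zero_of_mul hq)
    have himage : {d ∈ (c * e).divisors | c ∣ d} = e.divisors.image (c * ·) := by
      ext d
      simp only [mem_filter, Nat.mem_divisors, mem_image]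
      constructor
      · rintro ⟨⟨hd, -⟩, t, rfl⟩
        exact ⟨t, ⟨Nat.dvd_of_mul_dvd_mul_left hc₀ hd, right_ne_zero_of_mul hq⟩, rfl⟩
      · rintro ⟨t, ⟨ht, -⟩, rfl⟩
        exact ⟨⟨mul_dvd_mul_left c ht, hq⟩, dvd_mul_right c t⟩
    rw [himage, sum_image fun _ _ _ _ h => Nat.eq_of_mul_eq_mul_left hc₀ h]
    simp_rw [Nat.mul_div_mul_left _ _ hc₀]
    rw [Nat.sum_div_divisors e (μ ·), sum_divisors_moebius]
    simp only [left_eq_mul₀ hc₀.ne']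
  · rw [if_neg (by rintro rfl; exact hc dvd_rfl), sum_filter]
    exact sum_eq_zero fun d hd => if_neg fun hcd => hc (hcd.trans (Nat.dvd_of_mem_divisors hd))

theorem gcd_eq_sum_totient {q d : ℕ} (hd : d ∈ q.divisors) (e : ℕ) :
    d.gcd e = ∑ c ∈ q.divisors with c ∣ d ∧ c ∣ e, c.totient := by
  obtain ⟨hdq, hq⟩ := Nat.mem_divisors.1 hd
  rw [← Nat.sum_totient (d.gcd e)]
  refine sum_congr ?_ fun _ _ => rfl
  ext c
  simp only [Nat.mem_divisors, mem_filter, Nat.dvd_gcd_iff]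
  exact ⟨fun ⟨hc, _⟩ => ⟨⟨hc.1.trans hdq, hq⟩, hc⟩, fun ⟨_, hc⟩ =>
    ⟨hc, (Nat.gcd_pos_of_pos_left e (Nat.pos_of_mem_divisors hd)).ne'⟩⟩

theorem sum_sum_moebius_mul_gcd {q r : ℕ} (hq : q ≠ 0) (hr : r ≠ 0) :
    ∑ d ∈ q.divisors, ∑ e ∈ r.divisors, μ (q / d) * μ (r / e) * (d.gcd e : ℤ) =
      if q = r then (q.totient : ℤ) else 0 := by
  have hgcd : ∀ d ∈ q.divisors, ∀ e ∈ r.divisors, μ (q / d) * μ (r / e) * (d.gcd e : ℤ) =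
      ∑ c ∈ q.divisors, c.totient *
        ((if c ∣ d then μ (q / d) else 0) * (if c ∣ e then μ (r / e) else 0)) := by
    intro d hd e _
    rw [gcd_eq_sum_totient hd e, sum_filter, Nat.cast_sum, mul_sum]
    refine sum_congr rfl fun c _ => ?_
    by_cases hcd : c ∣ d <;> by_cases hce : c ∣ e <;> simp [hcd, hce, mul_comm]
  calc ∑ d ∈ q.divisors, ∑ e ∈ r.divisors, μ (q / d) * μ (r / e) * (d.gcd e : ℤ)
      = ∑ c ∈ q.divisors, c.totient * ((∑ d ∈ q.divisors with c ∣ d, μ (q / d)) *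
          ∑ e ∈ r.divisors with c ∣ e, μ (r / e)) := by
        rw [sum_congr rfl fun d hd => sum_congr rfl (hgcd d hd)]
        simp_rw [sum_filter, sum_mul_sum, mul_sum]
        rw [sum_congr rfl fun d _ => sum_comm, sum_comm]
    _ = ∑ c ∈ q.divisors, if c = q then (if q = r then (q.totient : ℤ) else 0) else 0 := by
        refine sum_congr rfl fun c _ => ?_
        rw [sum_moebius_div_of_dvd hq, sum_moebius_div_of_dvd hr]
        split_ifs <;> simp_all
    _ = _ := by simp [hq]

theorem abs_card_Ioc_modEq_sub_le {q : ℕ} (hq : 0 < q) (K v : ℕ) :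
    |(#{k ∈ Ioc 0 K | k ≡ v [MOD q]} : ℝ) - K / q| ≤ 1 := by
  have hmono : ⌊((0 : ℕ) - v : ℚ) / q⌋ ≤ ⌊((K : ℚ) - v) / q⌋ := by
    gcongr
    exact K.zero_le
  have hcard : (#{k ∈ Ioc 0 K | k ≡ v [MOD q]} : ℤ) = _ := Nat.Ioc_filter_modEq_card 0 K hq v
  rw [max_eq_left (sub_nonneg.2 hmono)] at hcard
  have hcardℚ : (#{k ∈ Ioc 0 K | k ≡ v [MOD q]} : ℚ) =
      (⌊((K : ℚ) - v) / q⌋ : ℚ) - ⌊((0 : ℕ) - v : ℚ) / q⌋ := by exact_mod_cast hcard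
  have hsplit : (K : ℚ) / q = (K - v) / q - ((0 : ℕ) - v) / q := by ring
  have hbound : |(#{k ∈ Ioc 0 K | k ≡ v [MOD q]} : ℚ) - K / q| ≤ 1 := by
    rw [hcardℚ, hsplit, abs_le]
    constructor <;>
      linarith [Int.floor_le (((K : ℚ) - v) / q), Int.lt_floor_add_one (((K : ℚ) - v) / q),
        Int.floor_le (((0 : ℕ) - v : ℚ) / q), Int.lt_floor_add_one (((0 : ℕ) - v : ℚ) / q)]
  simpa using (Rat.cast_le (K := ℝ)).2 hbound

section Progression

variable {q r m : ℕ} (a K : ℕ)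

theorem exists_dvd_mul_add_iff_modEq (hq : q ≠ 0) (hqm : q.Coprime m) :
    ∃ v, ∀ k, q ∣ k * m + a ↔ k ≡ v [MOD q] := by
  have : NeZero q := ⟨hq⟩
  obtain ⟨u, hu⟩ : IsUnit (m : ZMod q) := (ZMod.isUnit_iff_coprime m q).2 hqm.symm
  refine ⟨(-a * ↑u⁻¹ : ZMod q).val, fun k => ?_⟩
  rw [← ZMod.natCast_eq_zero_iff, ← ZMod.natCast_eq_natCast_iff, ZMod.natCast_zmod_val,
    Nat.cast_add, Nat.cast_mul, ← hu, ← eq_neg_iff_add_eq_zero, ← Units.eq_mul_inv_iff_mul_eq]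

theorem abs_card_dvd_mul_add_sub_le (hq : q ≠ 0) (hqm : q.Coprime m) :
    |(#{k ∈ Icc 1 K | q ∣ k * m + a} : ℝ) - K / q| ≤ 1 := by
  obtain ⟨v, hv⟩ := exists_dvd_mul_add_iff_modEq a hq hqm
  simp only [hv]
  exact abs_card_Ioc_modEq_sub_le (Nat.pos_of_ne_zero hq) K v

theorem abs_mul_card_dvd_and_dvd_sub_le {d e : ℕ} (hd : d ≠ 0) (he : e ≠ 0) (hdm : d.Coprime m)
    (hem : e.Coprime m) :
    |(d * e : ℝ) * #{k ∈ Icc 1 K | d ∣ k * m + a ∧ e ∣ k * m + a} - K * d.gcd e| ≤ d * e := by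
  have hlcm : d.lcm e ≠ 0 := Nat.lcm_ne_zero hd he
  have hcop : (d.lcm e).Coprime m :=
    (hdm.mul_left hem).coprime_dvd_left (Nat.lcm_dvd_mul d e)
  have hgcd : (d * e : ℝ) = d.gcd e * d.lcm e := by exact_mod_cast (Nat.gcd_mul_lcm d e).symm
  have hfactor : ∀ N : ℝ, (d * e : ℝ) * N - K * d.gcd e = d * e * (N - K / d.lcm e) := by
    intro N
    rw [hgcd]
    field_simp
  simp only [← Nat.lcm_dvd_iff]
  rw [hfactor, abs_mul, abs_of_nonneg (by positivity : (0 : ℝ) ≤ d * e)]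
  exact mul_le_of_le_one_right (by positivity) (abs_card_dvd_mul_add_sub_le a K hlcm hcop)

theorem sum_ramanujanSum_mul_eq :
    (∑ k ∈ Icc 1 K, ramanujanSum q (k * m + a) * ramanujanSum r (k * m + a) : ℤ) =
      ∑ d ∈ q.divisors, ∑ e ∈ r.divisors, μ (q / d) * μ (r / e) *
        (d * e * #{k ∈ Icc 1 K | d ∣ k * m + a ∧ e ∣ k * m + a}) := by
  simp_rw [ramanujanSum, sum_filter, sum_mul_sum, card_filter, Nat.cast_sum, mul_sum]
  rw [sum_comm]
  refine sum_congr rfl fun d _ => ?_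
  rw [sum_comm]
  refine sum_congr rfl fun e _ => sum_congr rfl fun k _ => ?_
  by_cases hd : d ∣ k * m + a <;> by_cases he : e ∣ k * m + a <;> simp [hd, he]
  ring

theorem abs_sum_ramanujanSum_mul_sub_le (hq : q ≠ 0) (hr : r ≠ 0) (hqm : q.Coprime m)
    (hrm : r.Coprime m) :
    |(∑ k ∈ Icc 1 K, ramanujanSum q (k * m + a) * ramanujanSum r (k * m + a) : ℝ) -
      K * (if q = r then (q.totient : ℝ) else 0)| ≤ σ 1 q * σ 1 r := by
  have hmain : (if q = r then (q.totient : ℝ) else 0) =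
      ∑ d ∈ q.divisors, ∑ e ∈ r.divisors, (μ (q / d) * μ (r / e) : ℝ) * d.gcd e := by
    exact_mod_cast (sum_sum_moebius_mul_gcd hq hr).symm
  have hcorr : (∑ k ∈ Icc 1 K, ramanujanSum q (k * m + a) * ramanujanSum r (k * m + a) : ℝ) =
      ∑ d ∈ q.divisors, ∑ e ∈ r.divisors, (μ (q / d) * μ (r / e) : ℝ) *
        (d * e * #{k ∈ Icc 1 K | d ∣ k * m + a ∧ e ∣ k * m + a}) := by
    exact_mod_cast sum_ramanujanSum_mul_eq a K
  have hμ : ∀ n, |(μ n : ℝ)| ≤ 1 := fun n => by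
    exact_mod_cast ArithmeticFunction.abs_moebius_le_one (n := n)
  rw [hmain, hcorr, mul_sum, ← sum_sub_distrib, ArithmeticFunction.sigma_one_apply,
    ArithmeticFunction.sigma_one_apply, Nat.cast_sum, Nat.cast_sum, sum_mul_sum]
  refine (abs_sum_le_sum_abs _ _).trans (sum_le_sum fun d hd => ?_)
  rw [mul_sum, ← sum_sub_distrib]
  refine (abs_sum_le_sum_abs _ _).trans (sum_le_sum fun e he => ?_)
  obtain ⟨hdq, -⟩ := Nat.mem_divisors.1 hd
  obtain ⟨her, -⟩ := Nat.mem_divisors.1 he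
  rw [mul_left_comm (K : ℝ), ← mul_sub, abs_mul, abs_mul]
  refine (mul_le_of_le_one_left (abs_nonneg _) (mul_le_one₀ (hμ _) (abs_nonneg _) (hμ _))).trans ?_
  exact abs_mul_card_dvd_and_dvd_sub_le a K (Nat.pos_of_mem_divisors hd).ne'
    (Nat.pos_of_mem_divisors he).ne' (hqm.coprime_dvd_left hdq) (hrm.coprime_dvd_left her)

end Progression

/-! ### The sieve -/

section Sieve

variable {m K : ℕ} {D S : Finset ℕ} (a : ℕ)

theorem sum_sq_sum_mul_ramanujanSum_le (K : ℕ) (hD : ∀ q ∈ D, q ≠ 0 ∧ q.Coprime m) (w : ℕ → ℝ) :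
    ∑ k ∈ Icc 1 K, (∑ q ∈ D, w q * ramanujanSum q (k * m + a)) ^ 2 ≤
      K * ∑ q ∈ D, w q ^ 2 * q.totient + (∑ q ∈ D, |w q| * σ 1 q) ^ 2 := by
  calc ∑ k ∈ Icc 1 K, (∑ q ∈ D, w q * ramanujanSum q (k * m + a)) ^ 2
      = ∑ q ∈ D, ∑ r ∈ D, w q * w r *
          ∑ k ∈ Icc 1 K, (ramanujanSum q (k * m + a) * ramanujanSum r (k * m + a) : ℝ) := by
        simp_rw [sq, sum_mul_sum, mul_sum]
        rw [sum_comm]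
        refine sum_congr rfl fun q _ => ?_
        rw [sum_comm]
        exact sum_congr rfl fun r _ => sum_congr rfl fun k _ => by ring
    _ ≤ ∑ q ∈ D, ∑ r ∈ D, (w q * w r * (K * if q = r then (q.totient : ℝ) else 0) +
          (|w q| * σ 1 q) * (|w r| * σ 1 r)) := by
        refine sum_le_sum fun q hq => sum_le_sum fun r hr => ?_
        rw [← sub_le_iff_le_add', ← mul_sub]
        refine (le_abs_self _).trans ?_
        rw [abs_mul, abs_mul, mul_mul_mul_comm |w q|]
        gcongr
        exact abs_sum_ramanujanSum_mul_sub_le a K (hD q hq).1 (hD r hr).1 (hD q hq).2 (hD r hr).2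
    _ = K * ∑ q ∈ D, w q ^ 2 * q.totient + (∑ q ∈ D, |w q| * σ 1 q) ^ 2 := by
        simp_rw [sum_add_distrib]
        rw [sq, sum_mul_sum, mul_sum]
        congr 1
        refine sum_congr rfl fun q hq => ?_
        simp only [mul_ite, mul_zero, sum_ite_eq, hq, if_true]
        ring

theorem card_mul_sq_sum_moebius_le (hS : S ⊆ Icc 1 K) (hD : ∀ q ∈ D, q ≠ 0 ∧ q.Coprime m)
    (hSD : ∀ k ∈ S, ∀ q ∈ D, q.Coprime (k * m + a)) (w : ℕ → ℝ) :
    #S * (∑ q ∈ D, w q * μ q) ^ 2 ≤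
      K * ∑ q ∈ D, w q ^ 2 * q.totient + (∑ q ∈ D, |w q| * σ 1 q) ^ 2 := by
  have hconst : ∀ k ∈ S, ∑ q ∈ D, w q * μ q = ∑ q ∈ D, w q * ramanujanSum q (k * m + a) :=
    fun k hk => sum_congr rfl fun q hq => by rw [ramanujanSum_of_coprime (hSD k hk q hq)]
  calc #S * (∑ q ∈ D, w q * μ q) ^ 2
      = ∑ k ∈ S, (∑ q ∈ D, w q * ramanujanSum q (k * m + a)) ^ 2 := by
        rw [← nsmul_eq_mul, ← sum_const]
        exact sum_congr rfl fun k hk => by rw [hconst k hk]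
    _ ≤ ∑ k ∈ Icc 1 K, (∑ q ∈ D, w q * ramanujanSum q (k * m + a)) ^ 2 :=
        sum_le_sum_of_subset_of_nonneg hS fun _ _ _ => sq_nonneg _
    _ ≤ _ := sum_sq_sum_mul_ramanujanSum_le a K hD w

-- The optimal weights are `μ q / φ q`; with `μ q / q` the error term is a sum of `σ q / q`, whose
-- average is bounded.
theorem card_mul_sq_sum_inv_le (hS : S ⊆ Icc 1 K) (hD : ∀ q ∈ D, Squarefree q ∧ q.Coprime m)
    (hSD : ∀ k ∈ S, ∀ q ∈ D, q.Coprime (k * m + a)) :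
    #S * (∑ q ∈ D, (q : ℝ)⁻¹) ^ 2 ≤
      K * ∑ q ∈ D, (q : ℝ)⁻¹ + (∑ q ∈ D, (q.abundancyIndex : ℝ)) ^ 2 := by
  have hμ : ∀ q ∈ D, (μ q : ℝ) ^ 2 = 1 := fun q hq => by
    exact_mod_cast ArithmeticFunction.moebius_sq_eq_one_of_squarefree (hD q hq).1
  have hμ_abs : ∀ q ∈ D, |(μ q : ℝ)| = 1 := fun q hq => by
    exact_mod_cast ArithmeticFunction.abs_moebius_eq_one_of_squarefree (hD q hq).1
  have hφ : ∀ q ∈ D, (μ q / q : ℝ) ^ 2 * q.totient ≤ (q : ℝ)⁻¹ := fun q hq => by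
    have hq₀ : (q : ℝ) ≠ 0 := by exact_mod_cast (hD q hq).1.ne_zero
    rw [div_pow, hμ q hq]
    calc 1 / (q : ℝ) ^ 2 * q.totient ≤ 1 / (q : ℝ) ^ 2 * q := by
          gcongr
          exact q.totient_le
      _ = (q : ℝ)⁻¹ := by field_simp
  have hH : ∑ q ∈ D, (q : ℝ)⁻¹ = ∑ q ∈ D, (μ q / q : ℝ) * μ q :=
    sum_congr rfl fun q hq => by rw [div_mul_eq_mul_div, ← sq, hμ q hq, one_div]
  have hσ : ∑ q ∈ D, (q.abundancyIndex : ℝ) = ∑ q ∈ D, |(μ q / q : ℝ)| * σ 1 q :=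
    sum_congr rfl fun q hq => by
      rw [abs_div, hμ_abs q hq, Nat.abs_cast, ArithmeticFunction.sigma_one_apply,
        Nat.abundancyIndex]
      push_cast
      ring
  calc #S * (∑ q ∈ D, (q : ℝ)⁻¹) ^ 2
      ≤ K * ∑ q ∈ D, (μ q / q : ℝ) ^ 2 * q.totient + (∑ q ∈ D, |(μ q / q : ℝ)| * σ 1 q) ^ 2 := by
        rw [hH]
        exact card_mul_sq_sum_moebius_le a hS (fun q hq => ⟨(hD q hq).1.ne_zero, (hD q hq).2⟩)
          hSD _
    _ ≤ _ := by
        rw [hσ]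
        gcongr with q hq
        exact hφ q hq

end Sieve

/-! ### The abundancy index -/

theorem abundancyIndex_eq_sum_inv (n : ℕ) :
    (n.abundancyIndex : ℝ) = ∑ d ∈ n.divisors, (d : ℝ)⁻¹ := by
  rw [← Nat.sum_div_divisors n fun d => (d : ℝ)⁻¹, Nat.abundancyIndex]
  push_cast
  rw [sum_div]
  refine sum_congr rfl fun d hd => ?_
  rw [Nat.cast_div (Nat.dvd_of_mem_divisors hd)
    (by exact_mod_cast (Nat.pos_of_mem_divisors hd).ne'), inv_div]

theorem abundancyIndex_nonneg (n : ℕ) : (0 : ℝ) ≤ n.abundancyIndex := by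
  rw [abundancyIndex_eq_sum_inv]
  positivity

theorem one_le_abundancyIndex {n : ℕ} (hn : n ≠ 0) : (1 : ℝ) ≤ n.abundancyIndex := by
  have h := Nat.abundancyIndex_le_of_dvd hn (one_dvd n)
  exact_mod_cast (by simpa [Nat.abundancyIndex] using h : 1 ≤ n.abundancyIndex)

theorem sum_Icc_inv_sq_le_two (n : ℕ) : ∑ b ∈ Icc 1 n, ((b : ℝ) ^ 2)⁻¹ ≤ 2 := by
  have hIoo : Ioo 0 (n + 1) = Icc 1 n := by ext; simp; lia
  simpa [hIoo] using sum_Ioo_inv_sq_le (α := ℝ) 0 (n + 1)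

theorem sum_abundancyIndex_le (n : ℕ) : ∑ j ∈ Icc 1 n, (j.abundancyIndex : ℝ) ≤ 2 * n := by
  have hcard : ∀ d, (#{j ∈ Icc 1 n | d ∣ j} : ℝ) ≤ n / d := fun d => by
    have h : #{j ∈ Icc 1 n | d ∣ j} = n / d := Nat.Ioc_filter_dvd_card_eq_div n d
    rw [h]
    exact Nat.cast_div_le
  calc ∑ j ∈ Icc 1 n, (j.abundancyIndex : ℝ)
      = ∑ j ∈ Icc 1 n, ∑ d ∈ Icc 1 n with d ∣ j, (d : ℝ)⁻¹ := by
        refine sum_congr rfl fun j hj => ?_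
        obtain ⟨hj₁, hjn⟩ := mem_Icc.1 hj
        rw [abundancyIndex_eq_sum_inv]
        refine sum_congr ?_ fun _ _ => rfl
        ext d
        simp only [Nat.mem_divisors, mem_filter, mem_Icc]
        exact ⟨fun ⟨hd, _⟩ => ⟨⟨Nat.pos_of_dvd_of_pos hd hj₁,
          (Nat.le_of_dvd hj₁ hd).trans hjn⟩, hd⟩, fun ⟨_, hd⟩ => ⟨hd, by lia⟩⟩
    _ = ∑ d ∈ Icc 1 n, #{j ∈ Icc 1 n | d ∣ j} * (d : ℝ)⁻¹ := by
        simp_rw [sum_filter]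
        rw [sum_comm]
        simp_rw [← sum_filter, sum_const, nsmul_eq_mul]
    _ ≤ ∑ d ∈ Icc 1 n, n * ((d : ℝ) ^ 2)⁻¹ := by
        refine sum_le_sum fun d _ => ?_
        calc #{j ∈ Icc 1 n | d ∣ j} * (d : ℝ)⁻¹ ≤ (n / d) * (d : ℝ)⁻¹ := by
              gcongr
              exact hcard d
          _ = n * ((d : ℝ) ^ 2)⁻¹ := by ring
    _ ≤ 2 * n := by
        rw [← mul_sum, mul_comm]
        gcongr
        exact sum_Icc_inv_sq_le_two n

theorem totient_mul_le (a b : ℕ) : (a * b).totient ≤ a * b.totient := by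
  induction a using Nat.recOnMul generalizing b with
  | zero => simp
  | one => simp
  | prime p hp =>
    by_cases hpb : p ∣ b
    · rw [Nat.totient_mul_of_prime_of_dvd hp hpb]
    · rw [Nat.totient_mul_of_prime_of_not_dvd hp hpb]
      gcongr
      exact Nat.sub_le p 1
  | mul x y hx hy =>
    rw [mul_assoc, mul_assoc]
    exact (hx (y * b)).trans (Nat.mul_le_mul_left x (hy b))

theorem totient_mul_abundancyIndex_le (n : ℕ) : (n.totient : ℝ) * n.abundancyIndex ≤ n := by
  calc (n.totient : ℝ) * n.abundancyIndex
      = ∑ d ∈ n.divisors, (n.totient : ℝ) * (d : ℝ)⁻¹ := by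
        rw [abundancyIndex_eq_sum_inv, mul_sum]
    _ ≤ ∑ d ∈ n.divisors, ((n / d).totient : ℝ) := by
        refine sum_le_sum fun d hd => ?_
        have hd₀ : (0 : ℝ) < d := by exact_mod_cast Nat.pos_of_mem_divisors hd
        have h : n.totient ≤ d * (n / d).totient := by
          simpa only [Nat.mul_div_cancel' (Nat.dvd_of_mem_divisors hd)] using
            totient_mul_le d (n / d)
        rw [← div_eq_mul_inv, div_le_iff₀' hd₀]
        exact_mod_cast h
    _ = n := by
        rw [Nat.sum_div_divisors n fun d => (d.totient : ℝ)]
        exact_mod_cast Nat.sum_totient n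

/-! ### Reciprocal sums of squarefree moduli -/

/-- The squarefree positive integers up to `z` coprime to `m`, the set of sifting moduli. -/
def squarefreeCoprimeTo (m z : ℕ) : Finset ℕ :=
  {d ∈ Icc 1 z | Squarefree d ∧ d.Coprime m}

theorem exists_sq_mul_mul_squarefree_coprime {n m : ℕ} (hn : n ≠ 0) :
    ∃ b e d, b ^ 2 * (e * d) = n ∧ e ∣ m ∧ Squarefree d ∧ d.Coprime m := by
  obtain ⟨s, b, -, -, hsb, hs⟩ := Nat.sq_mul_squarefree_of_pos (Nat.pos_of_ne_zero hn)
  obtain ⟨d, hd⟩ := Nat.gcd_dvd_left s m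
  have hds : d ∣ s := Dvd.intro_left _ hd.symm
  have hcop : (s.gcd m).Coprime d := Nat.coprime_of_squarefree_mul (hd ▸ hs)
  exact ⟨b, s.gcd m, d, by rw [← hd, hsb], Nat.gcd_dvd_right s m, hs.squarefree_of_dvd hds,
    Nat.eq_one_of_dvd_coprimes hcop (Nat.gcd_dvd_gcd_of_dvd_left m hds) (Nat.gcd_dvd_left d m)⟩

theorem Icc_subset_image_sq_mul_mul {m : ℕ} (hm : m ≠ 0) (z : ℕ) :
    Icc 1 z ⊆ (Icc 1 z ×ˢ m.divisors ×ˢ squarefreeCoprimeTo m z).image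
      fun t => t.1 ^ 2 * (t.2.1 * t.2.2) := by
  intro n hn
  obtain ⟨hn₁, hnz⟩ := mem_Icc.1 hn
  obtain ⟨b, e, d, hbed, hem, hd, hdm⟩ := exists_sq_mul_mul_squarefree_coprime (m := m)
    (Nat.one_le_iff_ne_zero.1 hn₁)
  have hIcc : ∀ k, k ∣ n → k ∈ Icc 1 z := fun k hk =>
    mem_Icc.2 ⟨Nat.pos_of_dvd_of_pos hk hn₁, (Nat.le_of_dvd hn₁ hk).trans hnz⟩
  have hb : b ∣ n := hbed ▸ (dvd_pow_self b two_ne_zero).mul_right _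
  have hdn : d ∣ n := hbed ▸ (dvd_mul_left d e).mul_left _
  refine mem_image.2 ⟨(b, e, d), ?_, hbed⟩
  simp only [mem_product, squarefreeCoprimeTo, mem_filter, Nat.mem_divisors]
  exact ⟨hIcc b hb, ⟨hem, hm⟩, hIcc d hdn, hd, hdm⟩

theorem log_add_one_le_mul_sum_squarefreeCoprimeTo {m : ℕ} (hm : m ≠ 0) (z : ℕ) :
    Real.log (z + 1) ≤ 2 * m.abundancyIndex * ∑ d ∈ squarefreeCoprimeTo m z, (d : ℝ)⁻¹ := by
  have hharm : Real.log (z + 1) ≤ ∑ n ∈ Icc 1 z, (n : ℝ)⁻¹ := by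
    simpa [harmonic_eq_sum_Icc] using log_add_one_le_harmonic z
  calc Real.log (z + 1) ≤ ∑ n ∈ Icc 1 z, (n : ℝ)⁻¹ := hharm
    _ ≤ ∑ t ∈ Icc 1 z ×ˢ m.divisors ×ˢ squarefreeCoprimeTo m z,
          ((t.1 ^ 2 * (t.2.1 * t.2.2) : ℕ) : ℝ)⁻¹ :=
        (sum_le_sum_of_subset_of_nonneg (Icc_subset_image_sq_mul_mul hm z)
          fun _ _ _ => by positivity).trans (sum_image_le_of_nonneg fun _ _ => by positivity)
    _ = (∑ b ∈ Icc 1 z, ((b : ℝ) ^ 2)⁻¹) *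
          (m.abundancyIndex * ∑ d ∈ squarefreeCoprimeTo m z, (d : ℝ)⁻¹) := by
        rw [abundancyIndex_eq_sum_inv, sum_mul_sum, ← sum_product', sum_mul_sum, ← sum_product']
        exact sum_congr rfl fun t _ => by push_cast; rw [mul_inv, mul_inv]
    _ ≤ 2 * (m.abundancyIndex * ∑ d ∈ squarefreeCoprimeTo m z, (d : ℝ)⁻¹) := by
        have := abundancyIndex_nonneg m
        gcongr
        exact sum_Icc_inv_sq_le_two z
    _ = _ := by ring

/-! ### The Brun–Titchmarsh inequality -/

/-- The number of primes among the terms `m + a, 2 m + a, …, K m + a`. -/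
def primeTermCount (a m K : ℕ) : ℕ :=
  #{k ∈ Icc 1 K | (k * m + a).Prime}

theorem one_le_sum_inv_squarefreeCoprimeTo (m : ℕ) {z : ℕ} (hz : z ≠ 0) :
    1 ≤ ∑ d ∈ squarefreeCoprimeTo m z, (d : ℝ)⁻¹ := by
  have hone : 1 ∈ squarefreeCoprimeTo m z := by
    simp [squarefreeCoprimeTo, Nat.one_le_iff_ne_zero, hz]
  simpa using single_le_sum (f := fun d : ℕ => (d : ℝ)⁻¹) (fun _ _ => by positivity) hone

theorem primeTermCount_le_div_add (a K : ℕ) {m z : ℕ} (hm : m ≠ 0) (hz : z ≠ 0) :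
    (primeTermCount a m K : ℝ) ≤
      K / (∑ d ∈ squarefreeCoprimeTo m z, (d : ℝ)⁻¹) + 5 * z ^ 2 := by
  set D := squarefreeCoprimeTo m z with hD
  set H := ∑ d ∈ D, (d : ℝ)⁻¹
  set S := {k ∈ Icc 1 K | (k * m + a).Prime ∧ z < k}
  have hmem : ∀ d ∈ D, (1 ≤ d ∧ d ≤ z) ∧ Squarefree d ∧ d.Coprime m := fun d hd => by
    simpa only [hD, squarefreeCoprimeTo, mem_filter, mem_Icc] using hd
  have hcop : ∀ k ∈ S, ∀ d ∈ D, d.Coprime (k * m + a) := fun k hk d hd => by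
    obtain ⟨-, hprime, hzk⟩ := mem_filter.1 hk
    have hkm : k ≤ k * m := Nat.le_mul_of_pos_right k (Nat.pos_of_ne_zero hm)
    obtain ⟨⟨hd₁, hdz⟩, -⟩ := hmem d hd
    exact (Nat.coprime_of_lt_prime (by lia) (by lia) hprime).symm
  have hS : (#S : ℝ) ≤ K / H + 4 * z ^ 2 := by
    have hH : 1 ≤ H := one_le_sum_inv_squarefreeCoprimeTo m hz
    have hindex : ∑ d ∈ D, (d.abundancyIndex : ℝ) ≤ 2 * z :=
      (sum_le_sum_of_subset_of_nonneg (filter_subset _ _)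
        fun d _ _ => abundancyIndex_nonneg d).trans (sum_abundancyIndex_le z)
    refine le_of_mul_le_mul_right ?_ (by positivity : 0 < H ^ 2)
    calc #S * H ^ 2 ≤ K * H + (∑ d ∈ D, (d.abundancyIndex : ℝ)) ^ 2 :=
          card_mul_sq_sum_inv_le a (filter_subset _ _) (fun d hd => (hmem d hd).2) hcop
      _ ≤ K * H + (2 * z) ^ 2 * H ^ 2 := by
          gcongr
          refine le_trans ?_ (le_mul_of_one_le_right (by positivity) (one_le_pow₀ hH))
          gcongr
          exact sum_nonneg fun d _ => abundancyIndex_nonneg d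
      _ = (K / H + 4 * z ^ 2) * H ^ 2 := by
          field_simp
          ring
  have hsmall : primeTermCount a m K ≤ #S + z := by
    have hcover : {k ∈ Icc 1 K | (k * m + a).Prime} ⊆ S ∪ Icc 1 z := fun k hk => by
      simp only [S, mem_union, mem_filter, mem_Icc] at hk ⊢
      lia
    simpa [primeTermCount] using (card_le_card hcover).trans (card_union_le S (Icc 1 z))
  have hz_sq : (z : ℝ) ≤ z ^ 2 := by exact_mod_cast Nat.le_self_pow two_ne_zero z
  have hsmall' : (primeTermCount a m K : ℝ) ≤ #S + z := by exact_mod_cast hsmall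
  linarith

theorem log_add_one_le_two_mul_sqrt {x : ℝ} (hx : 0 ≤ x) : Real.log (x + 1) ≤ 2 * √x := by
  have hsq : x + 1 ≤ (√x + 1) ^ 2 := by nlinarith [Real.sq_sqrt hx, Real.sqrt_nonneg x]
  calc Real.log (x + 1) ≤ Real.log ((√x + 1) ^ 2) := Real.log_le_log (by linarith) hsq
    _ = 2 * Real.log (√x + 1) := by rw [Real.log_pow, Nat.cast_ofNat]
    _ ≤ 2 * √x := by
        gcongr
        linarith [Real.log_le_sub_one_of_pos (by positivity : 0 < √x + 1)]

theorem sqrt_le_two_mul_div_log {x : ℝ} (hx : 0 < x) : √x ≤ 2 * (x / Real.log (x + 1)) := by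
  rw [← mul_div_assoc, le_div_iff₀ (Real.log_pos (by linarith))]
  calc √x * Real.log (x + 1) ≤ √x * (2 * √x) := by
        gcongr
        exact log_add_one_le_two_mul_sqrt hx.le
    _ = 2 * x := by rw [mul_left_comm, Real.mul_self_sqrt hx.le]

theorem primeTermCount_le (a K : ℕ) {m : ℕ} (hm : m ≠ 0) :
    (primeTermCount a m K : ℝ) ≤ 18 * m.abundancyIndex * (K / Real.log (K + 1)) := by
  rcases eq_or_ne K 0 with rfl | hK
  · simp [primeTermCount]
  set z := Nat.nthRoot 4 K
  set H := ∑ d ∈ squarefreeCoprimeTo m z, (d : ℝ)⁻¹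
  have hzK : (z : ℝ) ^ 4 ≤ K := by exact_mod_cast Nat.pow_nthRoot_le (.inl four_ne_zero)
  have hKz : (K + 1 : ℝ) ≤ (z + 1) ^ 4 := by
    exact_mod_cast Nat.lt_pow_nthRoot_add_one four_ne_zero K
  have hK₀ : (0 : ℝ) < K := by exact_mod_cast Nat.pos_of_ne_zero hK
  have hz : z ≠ 0 := fun hz => hK₀.not_ge (by simpa [hz] using hKz)
  have hL : 0 < Real.log (K + 1) := Real.log_pos (by linarith)
  have hmain : K / H ≤ 8 * m.abundancyIndex * (K / Real.log (K + 1)) := by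
    have hH : 1 ≤ H := one_le_sum_inv_squarefreeCoprimeTo m hz
    have hlog : Real.log (K + 1) ≤ 8 * m.abundancyIndex * H := by
      calc Real.log (K + 1) ≤ Real.log ((z + 1) ^ 4) := Real.log_le_log (by linarith) hKz
        _ = 4 * Real.log (z + 1) := by rw [Real.log_pow, Nat.cast_ofNat]
        _ ≤ 4 * (2 * m.abundancyIndex * H) := by
            gcongr
            exact log_add_one_le_mul_sum_squarefreeCoprimeTo hm z
        _ = _ := by ring
    rw [← mul_div_assoc, div_le_div_iff₀ (by linarith) hL]
    calc K * Real.log (K + 1) ≤ K * (8 * m.abundancyIndex * H) := by gcongr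
      _ = _ := by ring
  have herror : (z : ℝ) ^ 2 ≤ 2 * (K / Real.log (K + 1)) :=
    (Real.le_sqrt_of_sq_le (by rwa [← pow_mul])).trans (sqrt_le_two_mul_div_log hK₀)
  have hindex : K / Real.log (K + 1) ≤ m.abundancyIndex * (K / Real.log (K + 1)) :=
    le_mul_of_one_le_left (by positivity) (one_le_abundancyIndex hm)
  linarith [primeTermCount_le_div_add a K hm hz]

theorem sum_primeTermCount_comm (a M K : ℕ) :
    ∑ m ∈ Icc 1 M, primeTermCount a m K = ∑ k ∈ Icc 1 K, primeTermCount a k M := by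
  simp_rw [primeTermCount, card_filter]
  rw [sum_comm]
  simp_rw [mul_comm]

theorem sum_primeTermCount_le (a M K : ℕ) :
    ∑ m ∈ Icc 1 M, (primeTermCount a m K : ℝ) ≤ 36 * K * (M / Real.log (M + 1)) := by
  calc ∑ m ∈ Icc 1 M, (primeTermCount a m K : ℝ)
      = ∑ k ∈ Icc 1 K, (primeTermCount a k M : ℝ) := by
        exact_mod_cast sum_primeTermCount_comm a M K
    _ ≤ ∑ k ∈ Icc 1 K, 18 * (k.abundancyIndex : ℝ) * (M / Real.log (M + 1)) :=
        sum_le_sum fun k hk =>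
          primeTermCount_le a M (Nat.one_le_iff_ne_zero.1 (mem_Icc.1 hk).1)
    _ = 18 * (M / Real.log (M + 1)) * ∑ k ∈ Icc 1 K, (k.abundancyIndex : ℝ) := by
        rw [mul_sum]
        exact sum_congr rfl fun k _ => by ring
    _ ≤ 18 * (M / Real.log (M + 1)) * (2 * K) := by
        have : 0 ≤ Real.log (M + 1 : ℝ) := Real.log_nonneg (by simp)
        gcongr
        exact sum_abundancyIndex_le K
    _ = _ := by ring

/-! ### The integral of the prime counting function -/

/-- The integral `∫₂ᵇ π(t; m, 1) / (t - 1)² dt` of the theorem, oriented when `b < 2`. -/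
noncomputable def primesInAPIntegral (m : ℕ) (b : ℝ) : ℝ :=
  ∫ t in (2 : ℝ)..b, (primesInAP t m 1 : ℝ) / (t - 1) ^ 2

theorem monotone_primesInAP (m a : ℕ) : Monotone fun t => (primesInAP t m a : ℝ) :=
  fun _ _ hst => Nat.cast_le.2 <| card_le_card <| filter_subset_filter _ <|
    Iic_subset_Iic.2 <| Nat.floor_le_floor hst

theorem intervalIntegrable_primesInAP_div (m a : ℕ) {b c : ℝ} (hb : 1 < b) (hbc : b ≤ c) :
    IntervalIntegrable (fun t => (primesInAP t m a : ℝ) / (t - 1) ^ 2)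
      MeasureTheory.volume b c := by
  simp_rw [div_eq_mul_inv]
  refine (monotone_primesInAP m a).intervalIntegrable.mul_continuousOn ?_
  refine ContinuousOn.inv₀ (by fun_prop) fun t ht => ?_
  rw [Set.uIcc_of_le hbc] at ht
  have : 0 < t - 1 := by linarith [ht.1]
  positivity

section Integral

variable {m : ℕ}

theorem exists_eq_mul_add_one_of_modEq_one {p : ℕ} (hp : 1 < p) (hpm : p ≡ 1 [MOD m]) :
    ∃ j, 1 ≤ j ∧ p = j * m + 1 := by
  obtain ⟨j, hj⟩ := (Nat.modEq_iff_dvd' hp.le).1 hpm.symm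
  refine ⟨j, Nat.one_le_iff_ne_zero.2 ?_, by lia⟩
  rintro rfl
  lia

theorem primesInAP_one_le {k : ℕ} {t : ℝ} (ht : t < (k + 1) * m + 1) :
    primesInAP t m 1 ≤ primeTermCount 1 m k := by
  have hsub : {p ∈ Iic ⌊t⌋₊ | p.Prime ∧ p ≡ 1 [MOD m]} ⊆
      {j ∈ Icc 1 k | (j * m + 1).Prime}.image fun j => j * m + 1 := by
    intro p hp
    simp only [mem_filter, mem_Iic] at hp
    obtain ⟨hpt, hprime, hpm⟩ := hp
    obtain ⟨j, hj, rfl⟩ := exists_eq_mul_add_one_of_modEq_one hprime.one_lt hpm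
    have hlt : j * m + 1 < (k + 1) * m + 1 := by
      exact_mod_cast ((Nat.le_floor_iff' hprime.ne_zero).1 hpt).trans_lt ht
    have hjk : j < k + 1 := Nat.lt_of_mul_lt_mul_right (Nat.lt_of_add_lt_add_right hlt)
    exact mem_image.2 ⟨j, mem_filter.2 ⟨mem_Icc.2 ⟨hj, Nat.lt_succ_iff.1 hjk⟩, hprime⟩, rfl⟩
  exact (card_le_card hsub).trans card_image_le

theorem primesInAPIntegral_eq_zero (hm : m ≠ 0) {b : ℝ} (hb : b ≤ m + 1) :
    primesInAPIntegral m b = 0 := by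
  have hm₁ : (1 : ℝ) ≤ m := by exact_mod_cast Nat.one_le_iff_ne_zero.2 hm
  refine (intervalIntegral.integral_congr_uIoo fun t ht => ?_).trans
    intervalIntegral.integral_zero
  have ht' : t < m + 1 := ht.2.trans_le (max_le (by linarith) hb)
  have hzero : primesInAP t m 1 = 0 := by
    simpa [primeTermCount] using primesInAP_one_le (k := 0) (by simpa using ht')
  simp [hzero]

theorem primesInAPIntegral_nonneg (hm : m ≠ 0) (b : ℝ) : 0 ≤ primesInAPIntegral m b := by
  rcases le_total 2 b with hb | hb
  · exact intervalIntegral.integral_nonneg hb fun _ _ => by positivity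
  · have hm₁ : (1 : ℝ) ≤ m := by exact_mod_cast Nat.one_le_iff_ne_zero.2 hm
    exact (primesInAPIntegral_eq_zero hm (by linarith)).ge

theorem integral_primesInAP_div_le {k : ℕ} (hm : m ≠ 0) (hk : k ≠ 0) :
    ∫ t in (k * m + 1 : ℝ)..((k + 1 : ℕ) * m + 1), (primesInAP t m 1 : ℝ) / (t - 1) ^ 2 ≤
      primeTermCount 1 m k / (k : ℝ) ^ 2 / m := by
  have hm₀ : (0 : ℝ) < m := by exact_mod_cast Nat.pos_of_ne_zero hm
  have hk₀ : (0 : ℝ) < k := by exact_mod_cast Nat.pos_of_ne_zero hk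
  have hle : (k * m + 1 : ℝ) ≤ (k + 1 : ℕ) * m + 1 := by push_cast; linarith
  calc ∫ t in (k * m + 1 : ℝ)..((k + 1 : ℕ) * m + 1), (primesInAP t m 1 : ℝ) / (t - 1) ^ 2
      ≤ ∫ _ in (k * m + 1 : ℝ)..((k + 1 : ℕ) * m + 1),
          (primeTermCount 1 m k : ℝ) / (k * m : ℝ) ^ 2 := by
        refine intervalIntegral.integral_mono_on_of_le_Ioo hle
          (intervalIntegrable_primesInAP_div m 1 (by linarith [mul_pos hk₀ hm₀]) hle)
          intervalIntegrable_const fun t ht => ?_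
        have hcount : (primesInAP t m 1 : ℝ) ≤ primeTermCount 1 m k := by
          exact_mod_cast primesInAP_one_le (by simpa using ht.2)
        have hkm : (k * m : ℝ) ≤ t - 1 := by linarith [ht.1]
        gcongr
    _ = primeTermCount 1 m k / (k : ℝ) ^ 2 / m := by
        rw [intervalIntegral.integral_const, smul_eq_mul]
        push_cast
        field_simp
        ring

theorem primesInAPIntegral_le (hm : m ≠ 0) {N : ℕ} {b : ℝ} (hb : b ≤ (N + 1) * m + 1) :
    primesInAPIntegral m b ≤ (∑ k ∈ Icc 1 N, primeTermCount 1 m k / (k : ℝ) ^ 2) / m := by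
  have hm₁ : (1 : ℝ) ≤ m := by exact_mod_cast Nat.one_le_iff_ne_zero.2 hm
  rcases le_total b (m + 1) with hbm | hbm
  · rw [primesInAPIntegral_eq_zero hm hbm]
    positivity
  set f := fun t => (primesInAP t m 1 : ℝ) / (t - 1) ^ 2
  let node : ℕ → ℝ := fun k => k * m + 1
  have hnode : Monotone node := fun i j hij => by simp only [node]; gcongr
  have hnode₁ : node 1 = m + 1 := by simp [node]
  have hnode_top : node (N + 1) = (N + 1) * m + 1 := by simp [node]
  have hint : ∀ {c d : ℝ}, 2 ≤ c → c ≤ d → IntervalIntegrable f MeasureTheory.volume c d :=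
    fun hc hcd => intervalIntegrable_primesInAP_div m 1 (by linarith) hcd
  have htwo : 2 ≤ node 1 := by linarith
  have htop : node 1 ≤ node (N + 1) := hnode (by lia)
  calc primesInAPIntegral m b ≤ ∫ t in (2 : ℝ)..node (N + 1), f t :=
        intervalIntegral.integral_mono_interval le_rfl (by linarith) (hnode_top ▸ hb)
          (Filter.Eventually.of_forall fun t => by positivity) (hint le_rfl (htwo.trans htop))
    _ = primesInAPIntegral m (node 1) + ∫ t in node 1..node (N + 1), f t :=
        (intervalIntegral.integral_add_adjacent_intervals (hint le_rfl htwo)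
          (hint htwo htop)).symm
    _ = ∑ k ∈ Ico 1 (N + 1), ∫ t in node k..node (k + 1), f t := by
        rw [primesInAPIntegral_eq_zero hm hnode₁.le, zero_add,
          intervalIntegral.sum_integral_adjacent_intervals_Ico (by lia)]
        exact fun k hk => hint (htwo.trans (hnode hk.1)) (hnode k.le_succ)
    _ ≤ ∑ k ∈ Ico 1 (N + 1), primeTermCount 1 m k / (k : ℝ) ^ 2 / m :=
        sum_le_sum fun k hk =>
          integral_primesInAP_div_le hm (Nat.one_le_iff_ne_zero.1 (mem_Ico.1 hk).1)
    _ = (∑ k ∈ Icc 1 N, primeTermCount 1 m k / (k : ℝ) ^ 2) / m := by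
        rw [sum_div, Ico_add_one_right_eq_Icc]

end Integral

/-! ### Dyadic averages -/

theorem sq_sum_Icc_le (a : ℕ → ℝ) (N : ℕ) :
    (∑ k ∈ Icc 1 N, a k) ^ 2 ≤ 2 * ∑ k ∈ Icc 1 N, a k * ∑ l ∈ Icc 1 k, a l := by
  induction N with
  | zero => simp
  | succ N ih =>
    simp only [sum_Icc_succ_top (Nat.le_add_left 1 N)]
    nlinarith [sq_nonneg (a (N + 1))]

theorem one_div_mul_log_add_one_nonneg (k : ℕ) : 0 ≤ 1 / (k * Real.log (k + 1)) :=
  one_div_nonneg.2 (mul_nonneg k.cast_nonneg (Real.log_nonneg (by simp)))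

theorem harmonic_le_three_mul_log_add_one (k : ℕ) : (harmonic k : ℝ) ≤ 3 * Real.log (k + 1) := by
  rcases eq_or_ne k 0 with rfl | hk
  · simp
  have hk₁ : (1 : ℝ) ≤ k := by exact_mod_cast Nat.one_le_iff_ne_zero.2 hk
  have hlog_two : Real.log 2 ≤ Real.log (k + 1) := Real.log_le_log two_pos (by linarith)
  have hlog : Real.log k ≤ Real.log (k + 1) := Real.log_le_log (by linarith) (by linarith)
  linarith [harmonic_le_one_add_log k, Real.log_two_gt_d9]

theorem harmonic_eq_sum_Icc_one_div (k : ℕ) : (harmonic k : ℝ) = ∑ l ∈ Icc 1 k, 1 / (l : ℝ) := by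
  simp [harmonic_eq_sum_Icc]

theorem primeTermCount_div_sq_le {m : ℕ} (hm : m ≠ 0) (k : ℕ) :
    primeTermCount 1 m k / (k : ℝ) ^ 2 ≤
      18 * m.abundancyIndex * (1 / (k * Real.log (k + 1))) := by
  calc primeTermCount 1 m k / (k : ℝ) ^ 2
      ≤ 18 * m.abundancyIndex * (k / Real.log (k + 1)) / (k : ℝ) ^ 2 :=
        div_le_div_of_nonneg_right (primeTermCount_le 1 k hm) (by positivity)
    _ = 18 * m.abundancyIndex * (1 / (k * Real.log (k + 1))) := by
        rcases eq_or_ne k 0 with rfl | hk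
        · simp
        · field_simp

theorem sq_sum_primeTermCount_div_sq_le {m : ℕ} (hm : m ≠ 0) (N : ℕ) :
    (∑ k ∈ Icc 1 N, primeTermCount 1 m k / (k : ℝ) ^ 2) ^ 2 ≤
      36 * m.abundancyIndex * ∑ k ∈ Icc 1 N, 1 / (k * Real.log (k + 1)) *
        ∑ l ∈ Icc 1 k, primeTermCount 1 m l / (l : ℝ) ^ 2 := by
  calc (∑ k ∈ Icc 1 N, primeTermCount 1 m k / (k : ℝ) ^ 2) ^ 2
      ≤ 2 * ∑ k ∈ Icc 1 N, primeTermCount 1 m k / (k : ℝ) ^ 2 *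
          ∑ l ∈ Icc 1 k, primeTermCount 1 m l / (l : ℝ) ^ 2 := sq_sum_Icc_le _ N
    _ ≤ 2 * ∑ k ∈ Icc 1 N, 18 * m.abundancyIndex * (1 / (k * Real.log (k + 1))) *
          ∑ l ∈ Icc 1 k, primeTermCount 1 m l / (l : ℝ) ^ 2 := by
        gcongr with k
        exact primeTermCount_div_sq_le hm k
    _ = _ := by
        simp_rw [mul_assoc, ← mul_sum]
        ring

theorem totient_mul_primesInAPIntegral_sq_le {m N : ℕ} (hm : m ≠ 0) {b : ℝ}
    (hb : b ≤ (N + 1) * m + 1) :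
    m.totient * primesInAPIntegral m b ^ 2 ≤
      36 / m * ∑ k ∈ Icc 1 N, 1 / (k * Real.log (k + 1)) *
        ∑ l ∈ Icc 1 k, primeTermCount 1 m l / (l : ℝ) ^ 2 := by
  have hm₀ : (m : ℝ) ≠ 0 := Nat.cast_ne_zero.2 hm
  have hsq := sq_sum_primeTermCount_div_sq_le hm N
  set T := ∑ k ∈ Icc 1 N, 1 / (k * Real.log (k + 1)) *
    ∑ l ∈ Icc 1 k, primeTermCount 1 m l / (l : ℝ) ^ 2
  have hT : 0 ≤ T := sum_nonneg fun k _ =>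
    mul_nonneg (one_div_mul_log_add_one_nonneg k) (by positivity)
  calc m.totient * primesInAPIntegral m b ^ 2
      ≤ m.totient * ((∑ k ∈ Icc 1 N, primeTermCount 1 m k / (k : ℝ) ^ 2) / m) ^ 2 := by
        have := primesInAPIntegral_nonneg hm b
        gcongr
        exact primesInAPIntegral_le hm hb
    _ ≤ m.totient * (36 * m.abundancyIndex * T / (m : ℝ) ^ 2) := by
        rw [div_pow]
        gcongr
    _ = m.totient * m.abundancyIndex * (36 * T / (m : ℝ) ^ 2) := by ring
    _ ≤ m * (36 * T / (m : ℝ) ^ 2) := by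
        gcongr
        exact totient_mul_abundancyIndex_le m
    _ = 36 / m * T := by field_simp

theorem sum_sum_primeTermCount_div_sq_le (M k : ℕ) :
    ∑ l ∈ Icc 1 k, (∑ m ∈ Icc 1 M, (primeTermCount 1 m l : ℝ)) / (l : ℝ) ^ 2 ≤
      108 * (M / Real.log (M + 1)) * Real.log (k + 1) := by
  have hlog : 0 ≤ Real.log (M + 1 : ℝ) := Real.log_nonneg (by simp)
  calc ∑ l ∈ Icc 1 k, (∑ m ∈ Icc 1 M, (primeTermCount 1 m l : ℝ)) / (l : ℝ) ^ 2
      ≤ ∑ l ∈ Icc 1 k, 36 * l * (M / Real.log (M + 1)) / (l : ℝ) ^ 2 := by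
        gcongr with l
        exact sum_primeTermCount_le 1 M l
    _ = 36 * (M / Real.log (M + 1)) * harmonic k := by
        rw [harmonic_eq_sum_Icc_one_div, mul_sum]
        refine sum_congr rfl fun l hl => ?_
        have hl₀ : (l : ℝ) ≠ 0 := by exact_mod_cast Nat.one_le_iff_ne_zero.1 (mem_Icc.1 hl).1
        field_simp
    _ ≤ 36 * (M / Real.log (M + 1)) * (3 * Real.log (k + 1)) := by
        gcongr
        exact harmonic_le_three_mul_log_add_one k
    _ = _ := by ring

theorem sum_Ico_totient_mul_primesInAPIntegral_sq_le {M N : ℕ} (hM : M ≠ 0) {b : ℕ → ℝ}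
    (hb : ∀ m ∈ Ico M (2 * M), b m ≤ (N + 1) * m + 1) :
    ∑ m ∈ Ico M (2 * M), m.totient * primesInAPIntegral m (b m) ^ 2 ≤
      7776 / Real.log (2 * M + 1) * harmonic N := by
  have : (0 : ℝ) < M := by exact_mod_cast Nat.pos_of_ne_zero hM
  have hsub : Ico M (2 * M) ⊆ Icc 1 (2 * M) := fun m hm => by
    simp only [mem_Ico, mem_Icc] at hm ⊢
    lia
  calc ∑ m ∈ Ico M (2 * M), m.totient * primesInAPIntegral m (b m) ^ 2
      ≤ ∑ m ∈ Ico M (2 * M), 36 / M * ∑ k ∈ Icc 1 N, 1 / (k * Real.log (k + 1)) *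
          ∑ l ∈ Icc 1 k, primeTermCount 1 m l / (l : ℝ) ^ 2 := by
        refine sum_le_sum fun m hm => ?_
        have hMm : (M : ℝ) ≤ m := by exact_mod_cast (mem_Ico.1 hm).1
        refine (totient_mul_primesInAPIntegral_sq_le ?_ (hb m hm)).trans ?_
        · exact Nat.one_le_iff_ne_zero.1 (mem_Icc.1 (hsub hm)).1
        · gcongr
          exact sum_nonneg fun k _ =>
            mul_nonneg (one_div_mul_log_add_one_nonneg k) (by positivity)
    _ ≤ ∑ m ∈ Icc 1 (2 * M), 36 / M * ∑ k ∈ Icc 1 N, 1 / (k * Real.log (k + 1)) *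
          ∑ l ∈ Icc 1 k, primeTermCount 1 m l / (l : ℝ) ^ 2 :=
        sum_le_sum_of_subset_of_nonneg hsub fun m _ _ =>
          mul_nonneg (by positivity) (sum_nonneg fun k _ =>
            mul_nonneg (one_div_mul_log_add_one_nonneg k) (by positivity))
    _ = 36 / M * ∑ k ∈ Icc 1 N, 1 / (k * Real.log (k + 1)) *
          ∑ l ∈ Icc 1 k, (∑ m ∈ Icc 1 (2 * M), (primeTermCount 1 m l : ℝ)) / (l : ℝ) ^ 2 := by
        simp_rw [sum_div]
        rw [← mul_sum, sum_comm]
        simp_rw [← mul_sum]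
        congr! 3
        exact sum_comm
    _ ≤ 36 / M * ∑ k ∈ Icc 1 N, 1 / (k * Real.log (k + 1)) *
          (108 * ((2 * M : ℕ) / Real.log ((2 * M : ℕ) + 1)) * Real.log (k + 1)) := by
        gcongr with k
        · exact one_div_mul_log_add_one_nonneg k
        · exact sum_sum_primeTermCount_div_sq_le (2 * M) k
    _ = 7776 / Real.log (2 * M + 1) * harmonic N := by
        rw [harmonic_eq_sum_Icc_one_div, mul_sum, mul_sum]
        refine sum_congr rfl fun k hk => ?_
        have hk₀ : (0 : ℝ) < k := by exact_mod_cast (mem_Icc.1 hk).1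
        have hlog : Real.log (k + 1) ≠ 0 := (Real.log_pos (by linarith)).ne'
        push_cast
        field_simp
        ring

theorem sum_Ico_totient_mul_primesInAPIntegral_rpow_sq_le {M : ℕ} (hM : M ≠ 0) {ε : ℝ}
    (hε : 0 ≤ ε) :
    ∑ m ∈ Ico M (2 * M), m.totient * primesInAPIntegral m ((m : ℝ) ^ (1 + ε)) ^ 2 ≤
      7776 * (1 / Real.log (2 * M) + ε) := by
  have hM₁ : (1 : ℝ) ≤ M := by exact_mod_cast Nat.one_le_iff_ne_zero.2 hM
  have hlog : 0 < Real.log (2 * M) := Real.log_pos (by linarith)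
  set N := ⌊(2 * M : ℝ) ^ ε⌋₊
  have hharm₀ : (0 : ℝ) ≤ harmonic N := by
    rw [harmonic_eq_sum_Icc_one_div]
    positivity
  have hharm : (harmonic N : ℝ) ≤ 1 + ε * Real.log (2 * M) := by
    rw [← Real.log_rpow (by linarith)]
    exact harmonic_floor_le_one_add_log _ (Real.one_le_rpow (by linarith) hε)
  have hb : ∀ m ∈ Ico M (2 * M), (m : ℝ) ^ (1 + ε) ≤ (N + 1) * m + 1 := fun m hm => by
    have hm₀ : (0 : ℝ) < m := by
      exact_mod_cast (Nat.pos_of_ne_zero hM).trans_le (mem_Ico.1 hm).1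
    have hm_le : (m : ℝ) ≤ 2 * M := by exact_mod_cast (mem_Ico.1 hm).2.le
    calc (m : ℝ) ^ (1 + ε) = (m : ℝ) ^ ε * m := by rw [add_comm, Real.rpow_add_one hm₀.ne']
      _ ≤ (N + 1) * m := by
          gcongr
          exact (Real.rpow_le_rpow hm₀.le hm_le hε).trans (Nat.lt_floor_add_one _).le
      _ ≤ (N + 1) * m + 1 := by linarith
  calc ∑ m ∈ Ico M (2 * M), m.totient * primesInAPIntegral m ((m : ℝ) ^ (1 + ε)) ^ 2
      ≤ 7776 / Real.log (2 * M + 1) * harmonic N :=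
        sum_Ico_totient_mul_primesInAPIntegral_sq_le hM hb
    _ ≤ 7776 / Real.log (2 * M) * (1 + ε * Real.log (2 * M)) := by
        gcongr
        linarith
    _ = 7776 * (1 / Real.log (2 * M) + ε) := by field_simp

theorem sum_range_sum_Ico_two_pow {R : Type*} [AddCommMonoid R] (f : ℕ → R) (J : ℕ) :
    ∑ i ∈ range J, ∑ m ∈ Ico (2 ^ i) (2 * 2 ^ i), f m = ∑ m ∈ Ico 1 (2 ^ J), f m := by
  induction J with
  | zero => simp
  | succ J ih =>
    rw [sum_range_succ, ih, pow_succ']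
    exact sum_Ico_consecutive f Nat.one_le_two_pow (by lia)

theorem sum_Ico_two_pow_totient_mul_primesInAPIntegral_sq_le (J : ℕ) {ε : ℝ} (hε : 0 ≤ ε) :
    ∑ m ∈ Ico 1 (2 ^ J), m.totient * primesInAPIntegral m ((m : ℝ) ^ (1 + ε)) ^ 2 ≤
      7776 * (harmonic J / Real.log 2 + ε * J) := by
  calc ∑ m ∈ Ico 1 (2 ^ J), m.totient * primesInAPIntegral m ((m : ℝ) ^ (1 + ε)) ^ 2
      ≤ ∑ i ∈ range J, 7776 * (1 / Real.log (2 * (2 ^ i : ℕ)) + ε) := by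
        rw [← sum_range_sum_Ico_two_pow]
        exact sum_le_sum fun i _ =>
          sum_Ico_totient_mul_primesInAPIntegral_rpow_sq_le (by positivity) hε
    _ = 7776 * (harmonic J / Real.log 2 + ε * J) := by
        have hlog : ∀ i : ℕ, Real.log (2 * (2 ^ i : ℕ)) = (i + 1) * Real.log 2 := fun i => by
          rw [Nat.cast_pow, Nat.cast_ofNat, ← pow_succ', Real.log_pow, Nat.cast_add_one]
        simp only [hlog, ← mul_sum, sum_add_distrib, harmonic, sum_div, sum_const, card_range,
          nsmul_eq_mul, Rat.cast_sum, mul_comm ε]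
        congr! 3 with i
        push_cast
        field_simp

theorem natLog_two_floor_add_one_le {x : ℝ} (hx : Real.exp 1 ≤ x) :
    ((Nat.log 2 ⌊x⌋₊ + 1 : ℕ) : ℝ) ≤ 3 * Real.log x := by
  have hx₀ : 0 < x := (Real.exp_pos 1).trans_le hx
  have hlog : 1 ≤ Real.log x := (Real.le_log_iff_exp_le hx₀).2 hx
  have hfloor : ⌊x⌋₊ ≠ 0 := (Nat.floor_pos.2 (Real.one_le_exp zero_le_one |>.trans hx)).ne'
  have hpow : (2 : ℝ) ^ Nat.log 2 ⌊x⌋₊ ≤ x := by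
    exact_mod_cast (Nat.le_floor_iff hx₀.le).1 (Nat.pow_log_le_self 2 hfloor)
  have hmul : Nat.log 2 ⌊x⌋₊ * Real.log 2 ≤ Real.log x := by
    rw [← Real.log_pow]
    exact Real.log_le_log (by positivity) hpow
  push_cast
  nlinarith [Real.log_two_gt_d9]

theorem harmonic_div_log_two_le {J : ℕ} {y : ℝ} (hJ : J ≠ 0) (hy : Real.exp 1 ≤ y)
    (hJy : J ≤ 3 * y) : harmonic J / Real.log 2 ≤ 8 * Real.log y := by
  have hy₀ : 0 < y := (Real.exp_pos 1).trans_le hy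
  have hlog : 1 ≤ Real.log y := (Real.le_log_iff_exp_le hy₀).2 hy
  have hlog_three : Real.log 3 ≤ 2 := by
    linarith [Real.log_le_sub_one_of_pos (show (0 : ℝ) < 3 by norm_num)]
  have hlogJ : Real.log J ≤ 2 + Real.log y := by
    calc Real.log J ≤ Real.log (3 * y) := Real.log_le_log (by positivity) hJy
      _ = Real.log 3 + Real.log y := Real.log_mul (by norm_num) hy₀.ne'
      _ ≤ 2 + Real.log y := by gcongr
  rw [div_le_iff₀ (Real.log_pos one_lt_two)]
  nlinarith [harmonic_le_one_add_log J, Real.log_two_gt_d9]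

theorem proposition2_general :
    ∃ C : ℝ, 0 < C ∧ ∃ x₀ : ℝ, ∀ ε : ℝ, 0 ≤ ε → ∀ x : ℝ, x₀ ≤ x →
      ∑ m ∈ Icc 1 ⌊x⌋₊, (m.totient : ℝ) *
          (∫ t in (2 : ℝ)..((m : ℝ) ^ (1 + ε)), (primesInAP t m 1 : ℝ) / (t - 1) ^ 2) ^ 2 ≤
        C * (ε * Real.log x + Real.log (Real.log x)) := by
  refine ⟨62208, by norm_num, Real.exp (Real.exp 1), fun ε hε x hx => ?_⟩
  have hx₁ : Real.exp 1 ≤ x := (Real.exp_le_exp.2 (Real.one_le_exp zero_le_one)).trans hx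
  have hlog : Real.exp 1 ≤ Real.log x :=
    (Real.le_log_iff_exp_le ((Real.exp_pos 1).trans_le hx₁)).2 hx
  have hlog₀ : 0 ≤ Real.log x := (Real.exp_pos 1).le.trans hlog
  set J := Nat.log 2 ⌊x⌋₊ + 1
  have hJ : (J : ℝ) ≤ 3 * Real.log x := natLog_two_floor_add_one_le hx₁
  have hsub : Icc 1 ⌊x⌋₊ ⊆ Ico 1 (2 ^ J) := fun m hm =>
    mem_Ico.2 ⟨(mem_Icc.1 hm).1, (mem_Icc.1 hm).2.trans_lt (Nat.lt_pow_succ_log_self one_lt_two _)⟩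
  calc ∑ m ∈ Icc 1 ⌊x⌋₊, m.totient * primesInAPIntegral m ((m : ℝ) ^ (1 + ε)) ^ 2
      ≤ ∑ m ∈ Ico 1 (2 ^ J), m.totient * primesInAPIntegral m ((m : ℝ) ^ (1 + ε)) ^ 2 :=
        sum_le_sum_of_subset_of_nonneg hsub fun m _ _ => by positivity
    _ ≤ 7776 * (harmonic J / Real.log 2 + ε * J) :=
        sum_Ico_two_pow_totient_mul_primesInAPIntegral_sq_le J hε
    _ ≤ 7776 * (8 * Real.log (Real.log x) + ε * (3 * Real.log x)) := by
        gcongr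
        exact harmonic_div_log_two_le (Nat.succ_ne_zero _) hlog hJ
    _ ≤ 62208 * (ε * Real.log x + Real.log (Real.log x)) := by
        linarith [mul_nonneg hε hlog₀]

theorem proposition2 :
    ∃ C : ℝ, 0 < C ∧ ∃ ε₀ : ℝ, 0 < ε₀ ∧ ∃ x₀ : ℝ,
      ∀ ε : ℝ, 0 < ε → ε < ε₀ → ∀ x : ℝ, x₀ ≤ x →
        ∑ m ∈ Finset.Icc 1 ⌊x ^ (1 - ε)⌋₊,
            (Nat.totient m : ℝ) *
              (∫ t in (2 : ℝ)..((m : ℝ) ^ (1 + ε)),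
                (primesInAP t m 1 : ℝ) / (t - 1) ^ 2) ^ 2
          ≤ C * (ε * Real.log x + Real.log (Real.log x)) := by
  obtain ⟨C, hC, x₀, hsum⟩ := proposition2_general
  refine ⟨C, hC, 1, one_pos, max x₀ 1, fun ε hε _ x hx => ?_⟩
  have hpow : x ^ (1 - ε) ≤ x := Real.rpow_le_self_of_one_le (le_of_max_le_right hx) (by linarith)
  exact (sum_le_sum_of_subset_of_nonneg (Icc_subset_Icc_right (Nat.floor_le_floor hpow))
    fun m _ _ => by positivity).trans (hsum ε hε.le x (le_of_max_le_left hx))
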